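/- For a countable set $\Lambda\subset\mathbb R$ and coefficient functions $a,b:\Lambda\to\mathbb C$, write $a\sim b$ if there is a $\mathbb Q$-linear map $\psi$ from the $\mathbb Q$-span of $\Lambda$ to $\mathbb R$ with $b(\lambda)=a(\lambda)e^{i\psi(\lambda)}$ for all $\lambda\in\Lambda$. An integral basis of $\Lambda$ is a basis of the $\mathbb Q$-span of $\Lambda$ in which every $\lambda\in\Lambda$ has integer coordinates. A function $f$ is almost periodic on a vertical strip $\{\alpha<\operatorname{Re}s<\beta\}$ ($-\infty\le\alpha<\beta\le\infty$) if on every reduced strip $\{p\le\operatorname{Re}s\le q\}$, $\alpha<p\le q<\beta$, it is a uniform limit of exponential polynomials $\sum_j c_je^{\lambda_js}$ with complex coefficients and real exponents. It belongs to $\mathcal D_\Lambda$ if moreover its Dirichlet series is of the form $\sum_{\lambda\in\Lambda}a(\lambda)e^{\lambda s}$; that is, on every vertical line of the strip and for every $m\in\mathbb R$, $\lim_{T\to\infty}\frac1{2T}\int_{-T}^{T}f(\sigma+it)e^{-m(\sigma+it)}\,dt$ equals $a(m)$ if $m\in\Lambda$ and $0$ otherwise. Two functions of $\mathcal D_\Lambda$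 are equivalent if the coefficient functions of their Dirichlet series are equivalent under $\sim$. **Example.** Let $\Lambda=\{\log2,\log3,\log5\}$, which has an integral basis, and let $$f_1(s)=e^{s\log2}+e^{s\log3}+2e^{s\log5},\qquad f_2(s)=e^{s\log2}+2e^{s\log3}+e^{s\log5}.$$ These are exponential polynomials with exponents in $\Lambda$, and they belong to $\mathcal D_\Lambda$ on the whole plane ($\alpha=-\infty$, $\beta=\infty$). They are not equivalent, but, with $E=(-\infty,0)$, $$\bigcup_{\sigma\in E}\{f_1(\sigma+it):t\in\mathbb R\}=\bigcup_{\sigma\in E}\{f_2(\sigma+it):t\in\mathbb R\}=\{w\in\mathbb C:|w|<4\}.$$ Consequently, the converse of the theorem "equivalent functions of $\mathcal D_\Lambda$, where $\Lambda$ has an integral basis, take the same set of values on $\{s:\operatorname{Re}s\in E\}$ for every open $E\subset(\alpha,\beta)$" fails: for this $\Lambda$, $(\alpha,\beta)=(-\infty,\infty)$ and the fixed open set $E=(-\infty,0)$, it is not true that any two functions of $\mathcal D_\Lambda$ that take the same set of values on $\{s:\operatorname{Re}s\in E\}$ are equivalent. -/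

import Mathlib

noncomputable section

/-- The relation on coefficient functions `Λ → ℂ`: `a ∼ b` if there is a `ℚ`-linear map `ψ` from
the `ℚ`-vector space generated by `Λ` to `ℝ` such that `b(λ) = a(λ) e^{i ψ(λ)}` for `λ ∈ Λ`. -/
def CoeffEquiv (Λ : Set ℝ) (a b : Λ → ℂ) : Prop :=
  ∃ ψ : Submodule.span ℚ Λ →ₗ[ℚ] ℝ, ∀ l : Λ,
    b l = a l * Complex.exp (Complex.I * ((ψ ⟨l, Submodule.subset_span l.2⟩ : ℝ) : ℂ))

/-- `Λ` has an integral basis: the `ℚ`-vector space generated by `Λ` has a basis `G` such that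
every element of `Λ` is a finite combination of elements of `G` with integer coefficients. -/
def HasIntegralBasis (Λ : Set ℝ) : Prop :=
  ∃ G : Set ℝ, LinearIndependent ℚ (fun g : G => (g : ℝ)) ∧
    Submodule.span ℚ G = Submodule.span ℚ Λ ∧
    ∀ l ∈ Λ, l ∈ Submodule.span ℤ G

/-- `f` is an exponential polynomial `∑ c_λ e^{λ s}` (a finite sum) with exponents in `Λ`. -/
def IsExpPoly (Λ : Set ℝ) (f : ℂ → ℂ) : Prop :=
  ∃ (S : Finset ℝ) (c : ℝ → ℂ), (S : Set ℝ) ⊆ Λ ∧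
    ∀ s : ℂ, f s = ∑ l ∈ S, c l * Complex.exp ((l : ℂ) * s)

/-- `f` is almost periodic in the open vertical strip `α < Re s < β`: it can be approximated
uniformly by exponential polynomials with real exponents in every reduced strip
`p ≤ Re s ≤ q`, `α < p ≤ q < β`. -/
def IsAlmostPeriodicOnStrip (α β : EReal) (f : ℂ → ℂ) : Prop :=
  ∀ p q : ℝ, α < (p : EReal) → p ≤ q → (q : EReal) < β → ∀ ε : ℝ, 0 < ε →
    ∃ P : ℂ → ℂ, IsExpPoly Set.univ P ∧
      ∀ s : ℂ, p ≤ s.re → s.re ≤ q → ‖f s - P s‖ < ε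

open Classical in
/-- The Dirichlet series of `f` on the strip `α < Re s < β` is `∑_{λ ∈ Λ} a(λ) e^{λ s}`: on every
vertical line of the strip and for every real `m`, the mean value of `f(s) e^{-m s}` exists and
equals `a(m)` if `m ∈ Λ`, and `0` otherwise. -/
def HasDirichletSeries (Λ : Set ℝ) (α β : EReal) (f : ℂ → ℂ) (a : Λ → ℂ) : Prop :=
  ∀ σ : ℝ, α < (σ : EReal) → (σ : EReal) < β → ∀ m : ℝ,
    Filter.Tendsto
      (fun T : ℝ => ((1 / (2 * T) : ℝ) : ℂ) *
        ∫ t in (-T)..T, f ((σ : ℂ) + Complex.I * (t : ℂ)) *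
          Complex.exp (-((m : ℂ) * ((σ : ℂ) + Complex.I * (t : ℂ)))))
      Filter.atTop (nhds (if h : m ∈ Λ then a ⟨m, h⟩ else 0))

/-- The class `𝒟_Λ` on the strip `α < Re s < β`: almost periodic functions whose Dirichlet series
has its exponents in `Λ`. -/
def InClassD (Λ : Set ℝ) (α β : EReal) (f : ℂ → ℂ) : Prop :=
  IsAlmostPeriodicOnStrip α β f ∧ ∃ a : Λ → ℂ, HasDirichletSeries Λ α β f a

/-- Equivalence of two functions of the class `𝒟_Λ`: the coefficients of their Dirichlet series
are equivalent. -/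
def FunEquiv (Λ : Set ℝ) (α β : EReal) (f g : ℂ → ℂ) : Prop :=
  ∃ a b : Λ → ℂ, HasDirichletSeries Λ α β f a ∧ HasDirichletSeries Λ α β g b ∧
    CoeffEquiv Λ a b

/-- The set `⋃_{σ ∈ E} Img (f(σ + it))` of values of `f` on `{s : Re s ∈ E}`. -/
def valuesOver (E : Set ℝ) (f : ℂ → ℂ) : Set ℂ :=
  ⋃ σ ∈ E, Set.range fun t : ℝ => f ((σ : ℂ) + Complex.I * (t : ℂ))

/-- The converse of the equivalence theorem for given `Λ`, `(α, β)` and `E ⊆ (α, β)`: functions of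
the class `𝒟_Λ` taking the same values on `{s : Re s ∈ E}` are equivalent. -/
def SameValuesImpliesEquiv (Λ : Set ℝ) (α β : EReal) (E : Set ℝ) : Prop :=
  ∀ f g : ℂ → ℂ, InClassD Λ α β f → InClassD Λ α β g →
    valuesOver E f = valuesOver E g → FunEquiv Λ α β f g

/-- `Λ = {log 2, log 3, log 5}`. -/
def exLambda : Set ℝ := {Real.log 2, Real.log 3, Real.log 5}

/-- `f₁(s) = e^{s log 2} + e^{s log 3} + 2 e^{s log 5}`. -/
def exF₁ (s : ℂ) : ℂ :=
  Complex.exp (s * (Real.log 2 : ℂ)) + Complex.exp (s * (Real.log 3 : ℂ)) +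
    2 * Complex.exp (s * (Real.log 5 : ℂ))

/-- `f₂(s) = e^{s log 2} + 2 e^{s log 3} + e^{s log 5}`. -/
def exF₂ (s : ℂ) : ℂ :=
  Complex.exp (s * (Real.log 2 : ℂ)) + 2 * Complex.exp (s * (Real.log 3 : ℂ)) +
    Complex.exp (s * (Real.log 5 : ℂ))

end

open Complex Filter Topology

/-! Equivalence preserves the moduli of the Dirichlet coefficients, and mean values determine these
coefficients; at `log 5` the moduli are 2 and 1, so the functions are not equivalent. On `Re s < 0`
the triangle inequality bounds both functions strictly by 4. Conversely, since `log 2`, `log 3`,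
`log 5` are independent over `ℚ`, Kronecker's theorem and a Hurwitz argument
(`mem_valuesOver_expSum`) allow the phases of the three terms to be chosen freely. On `Re s = -1`
the terms have moduli 1/2, 1/3, 2/5 or 1/2, 2/3, 1/5, which are sides of triangles, so 0 is
attained; near `Re s = 0` aligned phases give moduli close to 4. Connectedness gives every modulus
in `[0, 4)`, and a common rotation gives every argument. -/

/-! ### Mean values and Kronecker's theorem -/

/-- The mean value of `t ↦ e^{iμt}` is `1` if `μ = 0` and `0` otherwise. -/
theorem tendsto_mean_exp (μ : ℝ) :
    Tendsto (fun T : ℝ => ((1 / (2 * T) : ℝ) : ℂ) * ∫ t in (-T)..T, exp (I * (μ * t : ℝ)))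
      atTop (𝓝 (if μ = 0 then 1 else 0)) := by
  split_ifs with h
  · refine tendsto_const_nhds.congr' ?_
    filter_upwards [eventually_gt_atTop 0] with T hT
    have hT' : (T : ℂ) ≠ 0 := by exact_mod_cast hT.ne'
    simp only [h, zero_mul, ofReal_zero, mul_zero, exp_zero, intervalIntegral.integral_const,
      real_smul, mul_one]
    push_cast
    field_simp
    ring
  · have hc : I * (μ : ℂ) ≠ 0 := mul_ne_zero I_ne_zero (by exact_mod_cast h)
    have hlim : Tendsto (fun T : ℝ => (1 / (2 * T)) * (2 / |μ|)) atTop (𝓝 0) := by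
      have h1 : Tendsto (fun T : ℝ => (2 * T)⁻¹) atTop (𝓝 0) :=
        tendsto_inv_atTop_zero.comp (tendsto_id.const_mul_atTop two_pos)
      simpa using h1.mul_const (2 / |μ|)
    refine squeeze_zero_norm' ?_ hlim
    filter_upwards [eventually_gt_atTop 0] with T hT
    have hint : ∫ t in (-T)..T, exp (I * (μ * t : ℝ)) =
        (exp (I * (μ * T : ℝ)) - exp (I * (μ * (-T) : ℝ))) / (I * μ) := by
      have := integral_exp_mul_complex (a := -T) (b := T) hc
      simpa [mul_assoc] using this
    rw [hint, norm_mul, norm_div, norm_mul, norm_I, one_mul, norm_real, norm_real,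
      Real.norm_of_nonneg (by positivity), Real.norm_eq_abs]
    gcongr
    refine (norm_sub_le _ _).trans ?_
    rw [norm_exp_I_mul_ofReal, norm_exp_I_mul_ofReal]
    norm_num

/-- The mean value of a trigonometric polynomial is the sum of its coefficients of frequency
zero. -/
theorem tendsto_mean_sum_exp {κ : Type*} (S : Finset κ) (c : κ → ℂ) (μ : κ → ℝ) :
    Tendsto (fun T : ℝ => ((1 / (2 * T) : ℝ) : ℂ) *
        ∫ t in (-T)..T, ∑ j ∈ S, c j * exp (I * (μ j * t : ℝ)))
      atTop (𝓝 (∑ j ∈ S, if μ j = 0 then c j else 0)) := by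
  have h := tendsto_finsetSum S fun j _ => (tendsto_mean_exp (μ j)).const_mul (c j)
  simp only [mul_ite, mul_one, mul_zero] at h
  refine h.congr fun T => ?_
  rw [intervalIntegral.integral_finsetSum fun j _ =>
    (by fun_prop : Continuous fun t : ℝ => c j * exp (I * (μ j * t : ℝ))).intervalIntegrable _ _,
    Finset.mul_sum]
  refine Finset.sum_congr rfl fun j _ => ?_
  rw [intervalIntegral.integral_const_mul]
  ring

theorem norm_le_of_tendsto_mean {f : ℝ → ℂ} {B : ℝ} {L : ℂ} (hf : ∀ t, ‖f t‖ ≤ B)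
    (h : Tendsto (fun T : ℝ => ((1 / (2 * T) : ℝ) : ℂ) * ∫ t in (-T)..T, f t) atTop (𝓝 L)) :
    ‖L‖ ≤ B := by
  refine le_of_tendsto h.norm ?_
  filter_upwards [eventually_gt_atTop 0] with T hT
  have h1 := intervalIntegral.norm_integral_le_of_norm_le_const (a := -T) (b := T) (C := B)
    fun t _ => hf t
  rw [norm_mul, norm_real, Real.norm_of_nonneg (by positivity)]
  calc 1 / (2 * T) * ‖∫ t in (-T)..T, f t‖ ≤ 1 / (2 * T) * (B * |T - -T|) := by gcongr
    _ = B := by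
      rw [sub_neg_eq_add, abs_of_pos (by linarith)]
      field_simp
      ring

theorem one_add_pow_mul_inv_exp (v : ℂ) (x t : ℝ) (k : ℕ) :
    (1 + v * exp (I * (x * t : ℝ))) ^ (2 * k) * ((v * exp (I * (x * t : ℝ))) ^ k)⁻¹ =
      ∑ a ∈ Finset.range (2 * k + 1), ((2 * k).choose a * (v ^ a * (v ^ k)⁻¹)) *
        exp (I * ((((a : ℤ) - k : ℤ) * x) * t : ℝ)) := by
  rw [add_comm, add_pow, Finset.sum_mul]
  refine Finset.sum_congr rfl fun a _ => ?_
  have : exp (I * ((((a : ℤ) - k : ℤ) * x) * t : ℝ)) =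
      exp (I * (x * t : ℝ)) ^ a * (exp (I * (x * t : ℝ)) ^ k)⁻¹ := by
    rw [← exp_nat_mul, ← exp_nat_mul, ← exp_neg, ← exp_add]
    congr 1
    push_cast
    ring
  rw [this, one_pow, mul_one, mul_pow, mul_pow, mul_inv]
  ring

/-- The mean value of the kernel `∏ (1 + wᵢ)²ᵏ wᵢ⁻ᵏ`, `wᵢ = vᵢ e^{iωᵢt}`, for independent
frequencies `ωᵢ`. -/
theorem tendsto_mean_kernel {ι : Type*} [Fintype ι] {ω : ι → ℝ} (hω : LinearIndependent ℚ ω)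
    {v : ι → ℂ} (hv : ∀ i, v i ≠ 0) (k : ℕ) :
    Tendsto (fun T : ℝ => ((1 / (2 * T) : ℝ) : ℂ) * ∫ t in (-T)..T,
        ∏ i, ((1 + v i * exp (I * (ω i * t : ℝ))) ^ (2 * k) *
          ((v i * exp (I * (ω i * t : ℝ))) ^ k)⁻¹))
      atTop (𝓝 ((k.centralBinom : ℂ) ^ Fintype.card ι)) := by
  classical
  have key : ∀ t : ℝ, ∏ i, ((1 + v i * exp (I * (ω i * t : ℝ))) ^ (2 * k) *
          ((v i * exp (I * (ω i * t : ℝ))) ^ k)⁻¹) =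
      ∑ p ∈ Fintype.piFinset fun _ : ι => Finset.range (2 * k + 1),
        (∏ i, ((2 * k).choose (p i) * (v i ^ p i * (v i ^ k)⁻¹) : ℂ)) *
          exp (I * ((∑ i, ((p i : ℤ) - k : ℤ) * ω i) * t : ℝ)) := by
    intro t
    simp_rw [one_add_pow_mul_inv_exp]
    rw [Finset.prod_univ_sum]
    refine Finset.sum_congr rfl fun p _ => ?_
    rw [Finset.prod_mul_distrib, ← exp_sum, ← Finset.mul_sum, Finset.sum_mul, ofReal_sum]
  simp_rw [key]
  convert tendsto_mean_sum_exp (Fintype.piFinset fun _ : ι => Finset.range (2 * k + 1)) _ _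
    using 2
  -- By independence only the central term of each binomial expansion has frequency zero.
  have hzero : ∀ p : ι → ℕ, ∑ i, ((p i : ℤ) - k : ℤ) * ω i = 0 → p = fun _ => k := by
    intro p hp
    have := Fintype.linearIndependent_iff.1 hω (fun i => ((p i : ℚ) - k)) (by
      rw [← hp]
      refine Finset.sum_congr rfl fun i _ => ?_
      rw [Rat.smul_def]
      push_cast
      ring)
    funext i
    exact_mod_cast sub_eq_zero.1 (this i)
  rw [Finset.sum_eq_single fun _ : ι => k]
  · rw [if_pos (by simp)]
    have : ∀ i, v i ^ k * (v i ^ k)⁻¹ = 1 := fun i => mul_inv_cancel₀ (pow_ne_zero _ (hv i))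
    simp [this, Nat.centralBinom]
  · intro p _ hp
    rw [if_neg fun h => hp (hzero p h)]
  · intro h
    exact absurd (Fintype.mem_piFinset.2 fun _ => Finset.mem_range.2 (by omega)) h

/-- **Kronecker's approximation theorem**: if the `ωᵢ` are linearly independent over `ℚ`, the
line `t ↦ (e^{iωᵢt})ᵢ` is dense in the torus. -/
theorem exists_forall_norm_exp_sub_lt {ι : Type*} [Fintype ι] {ω : ι → ℝ}
    (hω : LinearIndependent ℚ ω) {z : ι → ℂ} (hz : ∀ i, ‖z i‖ = 1) {ε : ℝ} (hε : 0 < ε) :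
    ∃ t : ℝ, ∀ i, ‖exp (I * (ω i * t : ℝ)) - z i‖ < ε := by
  -- If the line misses a neighbourhood of `z`, the kernel with `v = z⁻¹` is at most `(4 ^ n * q) ^
  -- k` in modulus with `q < 1`. Its mean, a power of the central binomial coefficient, is at least
  -- `(4 ^ k / (2k + 1)) ^ n`: only a polynomial loss, a contradiction for large `k`.
  by_contra! hcon
  have hz0 : ∀ i, z i ≠ 0 := fun i h => by simpa [h] using hz i
  set n := Fintype.card ι with hn
  -- For `|w| = 1` the parallelogram law gives `|1 + w|² = 4 - |w - 1|²`; the maximum keeps `q`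
  -- nonnegative when `ε` is large.
  set q : ℝ := max 0 (1 - ε ^ 2 / 4) with hq
  have hq0 : 0 ≤ q := le_max_left _ _
  have hq1 : q < 1 := max_lt one_pos (by linarith [pow_pos hε 2])
  have hle2 : ∀ w : ℂ, ‖w‖ = 1 → ‖1 + w‖ ^ 2 ≤ 4 := fun w hw => by
    have : ‖1 + w‖ ≤ 2 := (norm_add_le _ _).trans (by rw [hw, norm_one]; norm_num)
    nlinarith [norm_nonneg (1 + w)]
  have hpar : ∀ w : ℂ, ‖w‖ = 1 → ε ≤ ‖w - 1‖ → ‖1 + w‖ ^ 2 ≤ 4 * q := fun w hw hd => by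
    have h1 := parallelogram_law_with_norm ℝ w 1
    rw [hw, norm_one, add_comm w 1] at h1
    have h2 : 1 - ε ^ 2 / 4 ≤ q := le_max_right _ _
    nlinarith [mul_self_le_mul_self hε.le hd]
  have hbound : ∀ k : ℕ, (k.centralBinom : ℝ) ^ n ≤ (4 ^ n * q) ^ k := by
    intro k
    have := norm_le_of_tendsto_mean (B := (4 ^ n * q) ^ k) (fun t => ?_)
      (tendsto_mean_kernel hω (fun i => inv_ne_zero (hz0 i)) k)
    · simpa using this
    set w : ι → ℂ := fun i => (z i)⁻¹ * exp (I * (ω i * t : ℝ)) with hw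
    have hw1 : ∀ i, ‖w i‖ = 1 := fun i => by
      rw [hw, norm_mul, norm_inv, hz, norm_exp_I_mul_ofReal, inv_one, one_mul]
    obtain ⟨i₀, hi₀⟩ := hcon t
    have hd : ε ≤ ‖w i₀ - 1‖ := by
      have : exp (I * (ω i₀ * t : ℝ)) - z i₀ = z i₀ * (w i₀ - 1) := by
        rw [hw]; field_simp [hz0 i₀]
      rwa [this, norm_mul, hz, one_mul] at hi₀
    have hprod : ∏ i, ‖1 + w i‖ ^ 2 ≤ 4 ^ n * q := by
      classical
      rw [← Finset.mul_prod_erase _ _ (Finset.mem_univ i₀)]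
      have h1 : ∏ i ∈ Finset.univ.erase i₀, ‖1 + w i‖ ^ 2 ≤ 4 ^ (n - 1) := by
        refine (Finset.prod_le_prod (fun i _ => sq_nonneg _) fun i _ => hle2 _ (hw1 i)).trans_eq ?_
        rw [Finset.prod_const, Finset.card_erase_of_mem (Finset.mem_univ _), Finset.card_univ]
      have h2 : (4 : ℝ) ^ n = 4 * 4 ^ (n - 1) := by
        rw [← pow_succ', Nat.sub_add_cancel (Fintype.card_pos_iff.2 ⟨i₀⟩)]
      calc _ ≤ 4 * q * 4 ^ (n - 1) := by
            gcongr
            exact hpar _ (hw1 _) hd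
        _ = 4 ^ n * q := by rw [h2]; ring
    change ‖∏ i, ((1 + w i) ^ (2 * k) * (w i ^ k)⁻¹)‖ ≤ _
    rw [norm_prod]
    simp_rw [norm_mul, norm_inv, norm_pow, hw1, one_pow, inv_one, mul_one, pow_mul]
    rw [Finset.prod_pow]
    gcongr
  have hbound' : ∀ k : ℕ, 1 ≤ (2 * k + 1 : ℝ) ^ n * q ^ k := by
    intro k
    have h1 : (4 : ℝ) ^ k ≤ (2 * k + 1) * k.centralBinom := by
      exact_mod_cast Nat.four_pow_le_two_mul_add_one_mul_central_binom k
    have h2 : ((4 : ℝ) ^ k) ^ n ≤ (2 * k + 1 : ℝ) ^ n * q ^ k * (4 ^ k) ^ n :=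
      calc ((4 : ℝ) ^ k) ^ n ≤ ((2 * k + 1) * k.centralBinom) ^ n := by gcongr
        _ = (2 * k + 1) ^ n * (k.centralBinom : ℝ) ^ n := mul_pow _ _ _
        _ ≤ (2 * k + 1) ^ n * (4 ^ n * q) ^ k := by gcongr; exact hbound k
        _ = _ := by rw [mul_pow, ← pow_mul, ← pow_mul, mul_comm n k]; ring
    exact le_of_mul_le_mul_right (by simpa using h2) (by positivity)
  -- The factor `3 ^ n` comes from `2k + 1 ≤ 3k` for `k ≥ 1`.
  have hlim : Tendsto (fun k : ℕ => 3 ^ n * ((k : ℝ) ^ n * q ^ k)) atTop (𝓝 0) := by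
    simpa using (tendsto_pow_const_mul_const_pow_of_abs_lt_one n
      (by rwa [abs_of_nonneg hq0])).const_mul (3 ^ n)
  obtain ⟨k, hk, hk1⟩ := ((hlim.eventually_lt_const one_pos).and (eventually_ge_atTop 1)).exists
  have hk1' : (1 : ℝ) ≤ k := by exact_mod_cast hk1
  refine absurd (hbound' k) (not_le.2 (lt_of_le_of_lt ?_ hk))
  rw [← mul_assoc, ← mul_pow]
  gcongr
  linarith

/-! ### Stability of values and exponential sums -/

/-- A form of Hurwitz's theorem: a value that a non-constant entire function takes at `z₀` is
taken near `z₀` by all entire functions that are uniformly close to it there. -/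
theorem exists_eq_of_forall_norm_sub_le {g : ℂ → ℂ} (hg : Differentiable ℂ g) {z₀ : ℂ}
    (hne : ∃ z, g z ≠ g z₀) {r : ℝ} (hr : 0 < r) :
    ∃ δ > 0, ∀ f : ℂ → ℂ, Differentiable ℂ f →
      (∀ z ∈ Metric.closedBall z₀ r, ‖f z - g z‖ ≤ δ) →
      ∃ z ∈ Metric.closedBall z₀ r, f z = g z₀ := by
  have hev : ∀ᶠ z in 𝓝[≠] z₀, g z ≠ g z₀ := by
    refine ((hg.analyticAt z₀).eventually_eq_or_eventually_ne analyticAt_const).resolve_left ?_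
    intro h
    obtain ⟨z, hz⟩ := hne
    exact hz (((hg.differentiableOn.analyticOnNhd isOpen_univ).eqOn_of_preconnected_of_eventuallyEq
      analyticOnNhd_const isPreconnected_univ (Set.mem_univ z₀) h) (Set.mem_univ z))
  obtain ⟨ρ₀, hρ₀, hρ₀'⟩ := Metric.eventually_nhds_iff.1 (eventually_nhdsWithin_iff.1 hev)
  obtain ⟨ρ, hρ, hρlt⟩ := exists_between (lt_min hρ₀ hr)
  have hρr : Metric.closedBall z₀ ρ ⊆ Metric.closedBall z₀ r :=
    Metric.closedBall_subset_closedBall (hρlt.le.trans (min_le_right _ _))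
  have hsphere : ∀ z ∈ Metric.sphere z₀ ρ, 0 < ‖g z - g z₀‖ := fun z hz =>
    norm_pos_iff.2 (sub_ne_zero.2 (hρ₀' (by
      rw [Metric.mem_sphere.1 hz]; exact hρlt.trans_le (min_le_left _ _))
      (fun h => by
        rw [Set.mem_singleton_iff.1 h, Metric.mem_sphere, dist_self] at hz
        exact hρ.ne hz)))
  obtain ⟨ε, hε, hmin⟩ := (isCompact_sphere z₀ ρ).exists_forall_le'
    (f := fun z => ‖g z - g z₀‖) (by have := hg.continuous; fun_prop) hsphere
  -- With error `ε / 8`, `f` on the circle stays `ε - 2ε/8 = 3ε/4` away from `f z₀`. The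
  -- quantitative open mapping theorem then covers the disc of radius `3ε/8` about `f z₀`, which
  -- contains `g z₀`.
  refine ⟨ε / 8, by positivity, fun f hf hfg => ?_⟩
  have h0 := hfg z₀ (Metric.mem_closedBall_self hr.le)
  have hfs : ∀ z ∈ Metric.sphere z₀ ρ, 3 * ε / 4 ≤ ‖f z - f z₀‖ := fun z hz => by
    have h1 := hfg z (hρr (Metric.sphere_subset_closedBall hz))
    have h2 : ‖g z - g z₀‖ ≤ ‖f z - f z₀‖ + ‖f z - g z‖ + ‖f z₀ - g z₀‖ :=
      calc ‖g z - g z₀‖ = ‖(f z - f z₀) - (f z - g z) + (f z₀ - g z₀)‖ := by congr 1; ring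
        _ ≤ _ := (norm_add_le _ _).trans (by gcongr; exact norm_sub_le _ _)
    linarith [hmin z hz]
  have hfne : ∃ᶠ z in 𝓝 z₀, f z ≠ f z₀ := by
    intro h
    obtain ⟨z, hz⟩ := NormedSpace.sphere_nonempty (x := z₀) |>.2 hρ.le
    have := ((hf.differentiableOn.analyticOnNhd isOpen_univ).eqOn_of_preconnected_of_eventuallyEq
      analyticOnNhd_const isPreconnected_univ (Set.mem_univ z₀)
      (h.mono fun _ h => not_not.1 h)) (Set.mem_univ z)
    have h3 := hfs z hz
    rw [this, sub_self, norm_zero] at h3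
    linarith
  obtain ⟨z, hz, hfz⟩ := hf.diffContOnCl.ball_subset_image_closedBall hρ hfs hfne
    (show g z₀ ∈ Metric.ball (f z₀) (3 * ε / 4 / 2) by
      rw [Metric.mem_ball, dist_comm, dist_eq_norm]; linarith)
  exact ⟨z, hρr hz, hfz⟩

/-- The exponential polynomial `∑ cᵢ e^{ωᵢ s}`. -/
noncomputable def expSum {ι : Type*} [Fintype ι] (c : ι → ℂ) (ω : ι → ℝ) (s : ℂ) : ℂ :=
  ∑ i, c i * exp (s * ω i)

section expSum

variable {ι : Type*} [Fintype ι]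

theorem differentiable_expSum (c : ι → ℂ) (ω : ι → ℝ) : Differentiable ℂ (expSum c ω) := by
  unfold expSum
  fun_prop

theorem isExpPoly_expSum (c : ι → ℂ) {ω : ι → ℝ} (hω : Function.Injective ω) {Λ : Set ℝ}
    (hΛ : Set.range ω ⊆ Λ) : IsExpPoly Λ (expSum c ω) := by
  refine ⟨Finset.univ.map ⟨ω, hω⟩, Function.extend ω c 0, by simpa using hΛ, fun s => ?_⟩
  simp [expSum, hω.extend_apply, mul_comm s]

theorem hasDirichletSeries_expSum (c : ι → ℂ) {ω : ι → ℝ} (hω : Function.Injective ω)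
    (α β : EReal) :
    HasDirichletSeries (Set.range ω) α β (expSum c ω) fun l => Function.extend ω c 0 l := by
  intro σ _ _ m
  -- The factor `e^{(ωᵢ - m)σ}` is constant on the line and equals 1 for the one surviving frequency
  -- `ωᵢ = m`.
  have h := tendsto_mean_sum_exp Finset.univ (fun i => c i * exp (((ω i - m) * σ : ℝ)))
    (fun i => ω i - m)
  refine (h.congr fun T => ?_).mono_right (le_of_eq (congrArg 𝓝 ?_))
  · congr 1
    refine intervalIntegral.integral_congr fun t _ => ?_
    simp only [expSum, Finset.sum_mul]
    refine Finset.sum_congr rfl fun i _ => ?_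
    rw [mul_assoc, mul_assoc, ← exp_add, ← exp_add]
    congr 2
    push_cast
    ring
  · split_ifs with hm
    · obtain ⟨i, rfl⟩ := hm
      change _ = Function.extend ω c 0 (ω i)
      rw [hω.extend_apply, Finset.sum_eq_single i]
      · simp
      · intro j _ hj
        rw [if_neg (sub_ne_zero.2 (hω.ne hj))]
      · simp
    · exact Finset.sum_eq_zero fun i _ => if_neg fun h => hm ⟨i, sub_eq_zero.1 h⟩

theorem inClassD_expSum (c : ι → ℂ) {ω : ι → ℝ} (hω : Function.Injective ω) (α β : EReal) :
    InClassD (Set.range ω) α β (expSum c ω) :=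
  ⟨fun _ _ _ _ _ _ hε => ⟨expSum c ω, isExpPoly_expSum c hω (Set.subset_univ _),
    fun s _ _ => by simpa using hε⟩, _, hasDirichletSeries_expSum c hω α β⟩

/-- If the exponents are independent over `ℚ`, then over an open set of abscissas an exponential
sum takes every value that some rotation of its terms takes. -/
theorem mem_valuesOver_expSum {c : ι → ℂ} {ω : ι → ℝ} (hω : LinearIndependent ℚ ω)
    {E : Set ℝ} (hE : IsOpen E) {σ : ℝ} (hσ : σ ∈ E) {z : ι → ℂ} (hz : ∀ i, ‖z i‖ = 1)
    (hne : ∃ s, expSum (c * z) ω s ≠ expSum (c * z) ω σ) :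
    expSum (c * z) ω σ ∈ valuesOver E (expSum c ω) := by
  obtain ⟨r, hr, hrE⟩ := Metric.nhds_basis_closedBall.mem_iff.1 (hE.mem_nhds hσ)
  obtain ⟨δ, hδ, hclose⟩ :=
    exists_eq_of_forall_norm_sub_le (differentiable_expSum (c * z) ω) hne hr
  set M : ℝ := ∑ i, ‖c i‖ * Real.exp ((|σ| + r) * |ω i|) with hM
  have hM0 : 0 ≤ M := Finset.sum_nonneg fun i _ => by positivity
  -- A vertical shift by `t` keeps the abscissa and multiplies term `i` by `e^{iωᵢt}`, which is
  -- close to `z i`. The denominator `M + 1` avoids division by zero.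
  obtain ⟨t, ht⟩ := exists_forall_norm_exp_sub_lt hω hz
    (show 0 < δ / (M + 1) by positivity)
  obtain ⟨s, hs, hfs⟩ := hclose (fun s => expSum c ω (s + I * t))
    ((differentiable_expSum c ω).comp (by fun_prop)) fun s hs => by
      have hre : |s.re| ≤ |σ| + r := by
        have h1 := (abs_re_le_norm (s - σ)).trans (mem_closedBall_iff_norm.1 hs)
        rw [sub_re, ofReal_re] at h1
        linarith [abs_sub_abs_le_abs_sub s.re σ]
      calc ‖expSum c ω (s + I * t) - expSum (c * z) ω s‖
          = ‖∑ i, c i * exp (s * ω i) * (exp (I * (ω i * t : ℝ)) - z i)‖ := by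
            rw [expSum, expSum, ← Finset.sum_sub_distrib]
            congr 1
            refine Finset.sum_congr rfl fun i _ => ?_
            have : (s + I * t) * ω i = s * ω i + I * (ω i * t : ℝ) := by push_cast; ring
            rw [this, exp_add, Pi.mul_apply]
            ring
        _ ≤ ∑ i, ‖c i‖ * Real.exp ((|σ| + r) * |ω i|) * (δ / (M + 1)) := by
            refine norm_sum_le_of_le _ fun i _ => ?_
            rw [norm_mul, norm_mul, norm_exp]
            gcongr
            · rw [re_mul_ofReal]
              exact (le_abs_self _).trans (by rw [abs_mul]; gcongr)
            · exact (ht i).le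
        _ = M * (δ / (M + 1)) := by rw [hM, Finset.sum_mul]
        _ ≤ δ := by
            rw [mul_div_assoc', div_le_iff₀ (by positivity)]
            nlinarith
  refine Set.mem_iUnion₂.2 ⟨s.re, hrE ?_, s.im + t, ?_⟩
  · have h1 := (abs_re_le_norm (s - σ)).trans (mem_closedBall_iff_norm.1 hs)
    rwa [sub_re, ofReal_re, ← Real.dist_eq, ← Metric.mem_closedBall] at h1
  · have : ((s.re : ℂ) + I * ((s.im + t : ℝ) : ℂ)) = s + I * t := by
      conv_rhs => rw [← re_add_im s]
      push_cast
      ring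
    rw [← hfs, ← this]

end expSum

/-! ### The exponents and the coefficient invariant -/

/-- The logarithms of the primes are linearly independent over `ℚ`. -/
theorem Real.linearIndependent_log_primes :
    LinearIndependent ℚ fun p : Nat.Primes => Real.log (p : ℕ) := by
  rw [← LinearIndependent.iff_fractionRing (R := ℤ), linearIndependent_iff']
  intro S g hg q hq
  have hpos : ∀ p : Nat.Primes, (0 : ℝ) < ((p : ℕ) : ℝ) := fun p => by exact_mod_cast p.2.pos
  -- Exponentiating the integer relation gives a product of prime powers equal to 1; its `q`-adic
  -- valuation is `g q`.
  have h1 : ∏ p ∈ S, (((p : ℕ) : ℚ) ^ g p) = 1 := by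
    have : ∏ p ∈ S, (((p : ℕ) : ℝ) ^ g p) = 1 := by
      refine Real.eq_one_of_pos_of_log_eq_zero
        (Finset.prod_pos fun p _ => zpow_pos (hpos p) _) ?_
      rw [Real.log_prod fun p _ => (zpow_pos (hpos p) _).ne', ← hg]
      simp
    exact Rat.cast_injective (α := ℝ) (by push_cast; exact this)
  have : Fact (q : ℕ).Prime := ⟨q.2⟩
  have h2 : ∀ T : Finset Nat.Primes, padicValRat q (∏ p ∈ T, (((p : ℕ) : ℚ) ^ g p)) =
      ∑ p ∈ T, g p * padicValRat q ((p : ℕ) : ℚ) := by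
    classical
    intro T
    induction T using Finset.induction_on with
    | empty => simp
    | insert p T hp ih =>
      have hp0 : ∀ p : Nat.Primes, (((p : ℕ) : ℚ) ^ g p) ≠ 0 := fun p =>
        zpow_ne_zero _ (by exact_mod_cast p.2.ne_zero)
      rw [Finset.prod_insert hp, Finset.sum_insert hp,
        padicValRat.mul (hp0 p) (Finset.prod_ne_zero_iff.2 fun p _ => hp0 p), ih,
        padicValRat.zpow]
  have h3 := h2 S
  rw [h1, padicValRat.one, Finset.sum_eq_single q] at h3
  · rw [padicValRat.self q.2.one_lt, mul_one] at h3
    exact h3.symm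
  · intro p _ hpq
    have : Fact (p : ℕ).Prime := ⟨p.2⟩
    rw [padicValRat.of_nat, padicValNat_primes fun h => hpq (Subtype.ext h.symm)]
    simp
  · exact fun h => absurd hq h

/-- The exponents `log 2`, `log 3`, `log 5`. -/
noncomputable def exLog : Fin 3 → ℝ := ![Real.log 2, Real.log 3, Real.log 5]

theorem linearIndependent_exLog : LinearIndependent ℚ exLog := by
  let p : Fin 3 → Nat.Primes := ![⟨2, Nat.prime_two⟩, ⟨3, Nat.prime_three⟩, ⟨5, Nat.prime_five⟩]
  have hp : Function.Injective p := by
    intro i j h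
    have h' : ((p i : Nat.Primes) : ℕ) = p j := congrArg _ h
    fin_cases i <;> fin_cases j <;> first | rfl | exact absurd h' (by decide)
  convert Real.linearIndependent_log_primes.comp p hp using 1
  funext i
  fin_cases i <;> simp [exLog, p]

theorem injective_exLog : Function.Injective exLog := linearIndependent_exLog.injective

theorem range_exLog : Set.range exLog = exLambda := by
  ext x
  simp only [exLog, exLambda, Matrix.range_cons, Matrix.range_empty, Set.union_empty,
    Set.mem_union, Set.mem_singleton_iff, Set.mem_insert_iff]

theorem exF₁_eq_expSum : exF₁ = expSum (fun i => ((![1, 1, 2] i : ℝ) : ℂ)) exLog := by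
  funext s
  simp [exF₁, expSum, exLog, Fin.sum_univ_three]

theorem exF₂_eq_expSum : exF₂ = expSum (fun i => ((![1, 2, 1] i : ℝ) : ℂ)) exLog := by
  funext s
  simp [exF₂, expSum, exLog, Fin.sum_univ_three]

theorem hasIntegralBasis_exLambda : HasIntegralBasis exLambda := by
  refine ⟨exLambda, ?_, rfl, fun l hl => Submodule.subset_span hl⟩
  rw [← range_exLog]
  exact linearIndependent_exLog.linearIndepOn_id

/-- Limits are unique, so one vertical line suffices. This identifies the coefficients that
`FunEquiv` only asserts to exist. -/
theorem HasDirichletSeries.unique {Λ : Set ℝ} {f : ℂ → ℂ} {a b : Λ → ℂ}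
    (ha : HasDirichletSeries Λ ⊥ ⊤ f a) (hb : HasDirichletSeries Λ ⊥ ⊤ f b) : a = b := by
  funext l
  have := tendsto_nhds_unique (ha 0 (EReal.bot_lt_coe 0) (EReal.coe_lt_top 0) l)
    (hb 0 (EReal.bot_lt_coe 0) (EReal.coe_lt_top 0) l)
  simpa using this

theorem CoeffEquiv.norm_eq {Λ : Set ℝ} {a b : Λ → ℂ} (h : CoeffEquiv Λ a b) (l : Λ) :
    ‖b l‖ = ‖a l‖ := by
  obtain ⟨ψ, hψ⟩ := h
  rw [hψ, norm_mul, norm_exp_I_mul_ofReal, mul_one]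

theorem FunEquiv.norm_coeff_eq {ι : Type*} [Fintype ι] {ω : ι → ℝ} (hω : Function.Injective ω)
    {c d : ι → ℂ} (h : FunEquiv (Set.range ω) ⊥ ⊤ (expSum c ω) (expSum d ω)) (i : ι) :
    ‖d i‖ = ‖c i‖ := by
  obtain ⟨a, b, ha, hb, hab⟩ := h
  rw [ha.unique (hasDirichletSeries_expSum c hω _ _),
    hb.unique (hasDirichletSeries_expSum d hω _ _)] at hab
  simpa [hω.extend_apply] using hab.norm_eq ⟨ω i, i, rfl⟩

/-! ### The set of values on the left half-plane -/

theorem norm_exp_ofReal_mul_ofReal (x y : ℝ) : ‖exp ((x : ℂ) * (y : ℂ))‖ = Real.exp (x * y) := by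
  rw [← ofReal_mul, norm_exp_ofReal]

/-- Three nonnegative lengths satisfying the triangle inequalities are the sides of a triangle. -/
theorem exists_add_mul_exp_add_mul_exp_eq_zero {A B C : ℝ} (hA : 0 ≤ A) (hB : 0 ≤ B)
    (h1 : |A - B| ≤ C) (h2 : C ≤ A + B) :
    ∃ x y : ℝ, (A : ℂ) + B * exp (x * I) + C * exp (y * I) = 0 := by
  obtain ⟨x, hx⟩ : ∃ x : ℝ, ‖(A : ℂ) + B * exp (x * I)‖ = C := by
    refine mem_range_of_exists_le_of_exists_ge
      (f := fun x : ℝ => ‖(A : ℂ) + B * exp (x * I)‖) (by fun_prop) ⟨Real.pi, ?_⟩ ⟨0, ?_⟩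
    · rw [exp_pi_mul_I, mul_neg_one, ← sub_eq_add_neg, ← ofReal_sub, norm_real, Real.norm_eq_abs]
      exact h1
    · rw [ofReal_zero, zero_mul, exp_zero, mul_one, ← ofReal_add, norm_real, Real.norm_eq_abs,
        abs_of_nonneg (add_nonneg hA hB)]
      exact h2
  refine ⟨x, arg (-((A : ℂ) + B * exp (x * I))), ?_⟩
  have := norm_mul_exp_arg_mul_I (-((A : ℂ) + B * exp (x * I)))
  rw [norm_neg, hx] at this
  rw [this, add_neg_cancel]

/-- An exponential sum with frequencies `log 2`, `log 3`, `log 5` whose coefficients have moduli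
`c₀, c₁ ≥ 0`, `c₂ ≥ 1` is not constant. -/
theorem exists_expSum_exLog_ne {c : Fin 3 → ℝ} (hc : ∀ i, 0 ≤ c i) (hc2 : 1 ≤ c 2)
    (hsum : c 0 + c 1 + c 2 = 4) {z : Fin 3 → ℂ} (hz : ∀ i, ‖z i‖ = 1) (w : ℂ) :
    ∃ s, expSum ((fun i => (c i : ℂ)) * z) exLog s ≠ w := by
  by_contra! h
  have hterm : ∀ (x : ℝ) (i : Fin 3),
      ‖((c i : ℂ) * z i) * exp ((x : ℂ) * exLog i)‖ = c i * Real.exp (x * exLog i) := fun x i => by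
    rw [norm_mul, norm_mul, hz, norm_exp_ofReal_mul_ofReal, norm_real,
      Real.norm_of_nonneg (hc i), mul_one]
  have hpow : ∀ p : ℝ, 0 < p → Real.exp (4 * Real.log p) = p ^ 4 := fun p hp => by
    rw [← Real.exp_log (pow_pos hp 4), Real.log_pow]
    norm_num
  -- At `s = 4` the last term dominates: equality with the value at 0 would force `625 c₂ ≤ 4 + 16
  -- c₀ + 81 c₁ ≤ 247`.
  have h4 := (h ((4 : ℝ) : ℂ)).trans (h ((0 : ℝ) : ℂ)).symm
  simp only [expSum, Fin.sum_univ_three, Pi.mul_apply] at h4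
  have t0 := hterm 4 0
  have t1 := hterm 4 1
  have t2 := hterm 4 2
  have u0 := hterm 0 0
  have u1 := hterm 0 1
  have u2 := hterm 0 2
  rw [zero_mul, Real.exp_zero, mul_one] at u0 u1 u2
  rw [show Real.exp (4 * exLog 0) = 2 ^ 4 from hpow 2 two_pos] at t0
  rw [show Real.exp (4 * exLog 1) = 3 ^ 4 from hpow 3 three_pos] at t1
  rw [show Real.exp (4 * exLog 2) = 5 ^ 4 from hpow 5 (by norm_num)] at t2
  set A := ((c 0 : ℂ) * z 0) * exp (((4 : ℝ) : ℂ) * exLog 0)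
  set B := ((c 1 : ℂ) * z 1) * exp (((4 : ℝ) : ℂ) * exLog 1)
  set C := ((c 2 : ℂ) * z 2) * exp (((4 : ℝ) : ℂ) * exLog 2)
  have hC : C = (((c 0 : ℂ) * z 0) * exp (((0 : ℝ) : ℂ) * exLog 0) +
      ((c 1 : ℂ) * z 1) * exp (((0 : ℝ) : ℂ) * exLog 1) +
      ((c 2 : ℂ) * z 2) * exp (((0 : ℝ) : ℂ) * exLog 2)) - (A + B) := by
    rw [← h4]; ring
  have hn : ‖C‖ ≤ (c 0 + c 1 + c 2) + (c 0 * 2 ^ 4 + c 1 * 3 ^ 4) := by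
    rw [hC]
    refine (norm_sub_le _ _).trans (add_le_add (norm_add₃_le.trans_eq ?_)
      ((norm_add_le _ _).trans_eq ?_))
    · rw [u0, u1, u2]
    · rw [t0, t1]
  rw [show ‖C‖ = c 2 * 5 ^ 4 from t2] at hn
  linarith [hc 0, hc 1]

/-- The values that such a sum takes to the left of the imaginary axis fill the disc whose radius
is the sum of the coefficients, provided that the moduli of its terms on `Re s = -1` are the
sides of a triangle. -/
theorem valuesOver_Iio_expSum_exLog {c : Fin 3 → ℝ} (hc : ∀ i, 0 ≤ c i) (hc2 : 1 ≤ c 2)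
    (hsum : c 0 + c 1 + c 2 = 4) (h1 : |c 0 / 2 - c 1 / 3| ≤ c 2 / 5)
    (h2 : c 2 / 5 ≤ c 0 / 2 + c 1 / 3) :
    valuesOver (Set.Iio 0) (expSum (fun i => (c i : ℂ)) exLog) = {w : ℂ | ‖w‖ < 4} := by
  have hlog : ∀ i, 0 < exLog i := fun i => by
    fin_cases i <;> exact Real.log_pos (by norm_num)
  refine Set.Subset.antisymm ?_ fun w (hw : ‖w‖ < 4) => ?_
  · refine Set.iUnion₂_subset fun σ (hσ : σ < 0) => ?_
    rintro _ ⟨t, rfl⟩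
    have hlt : ∀ i, Real.exp (σ * exLog i) < 1 := fun i =>
      Real.exp_lt_one_iff.2 (mul_neg_of_neg_of_pos hσ (hlog i))
    have hterm : ∀ i, ‖(c i : ℂ) * exp ((σ + I * t) * exLog i)‖ = c i * Real.exp (σ * exLog i) :=
      fun i => by
        rw [norm_mul, norm_real, Real.norm_of_nonneg (hc i), norm_exp]
        simp
    calc ‖expSum (fun i => (c i : ℂ)) exLog (σ + I * t)‖
        ≤ ∑ i, c i * Real.exp (σ * exLog i) := norm_sum_le_of_le _ fun i _ => (hterm i).le
      _ < ∑ i, c i := Finset.sum_lt_sum (fun i _ => mul_le_of_le_one_right (hc i) (hlt i).le)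
          ⟨2, Finset.mem_univ _, mul_lt_of_lt_one_right (by linarith) (hlt 2)⟩
      _ = 4 := by rw [Fin.sum_univ_three, hsum]
  -- The parameters are the abscissa and two relative phases; the common phase is restored later by
  -- `u`.
  · let Ψ : ℝ × ℝ × ℝ → ℂ := fun p => (c 0 : ℂ) * exp (p.1 * exLog 0) +
      c 1 * exp (p.1 * exLog 1) * exp (p.2.1 * I) + c 2 * exp (p.1 * exLog 2) * exp (p.2.2 * I)
    have hΨ : Continuous Ψ := by fun_prop
    obtain ⟨x₀, y₀, hzero⟩ := exists_add_mul_exp_add_mul_exp_eq_zero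
      (div_nonneg (hc 0) zero_le_two) (div_nonneg (hc 1) zero_le_three) h1 h2
    have hinv : ∀ p : ℝ, 0 < p → exp (((-1 : ℝ) : ℂ) * Real.log p) = ((p⁻¹ : ℝ) : ℂ) :=
      fun p hp => by
        rw [← ofReal_mul, ← ofReal_exp, neg_one_mul, Real.exp_neg, Real.exp_log hp]
    have hΨ0 : Ψ (-1, x₀, y₀) = 0 := by
      rw [← hzero]
      simp only [Ψ, exLog, Matrix.cons_val]
      rw [hinv 2 two_pos, hinv 3 three_pos, hinv 5 (by norm_num)]
      push_cast
      ring
    have hΨ4 : ‖Ψ (0, 0, 0)‖ = 4 := by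
      have : Ψ (0, 0, 0) = ((c 0 + c 1 + c 2 : ℝ) : ℂ) := by simp [Ψ]
      rw [this, hsum]
      simp
    obtain ⟨σ₁, hσ₁, hσ₁'⟩ : ∃ σ < (0 : ℝ), ‖w‖ < ‖Ψ (σ, 0, 0)‖ := by
      have hcont : Continuous fun σ : ℝ => ‖Ψ (σ, 0, 0)‖ := by fun_prop
      have := (hcont.tendsto 0).eventually_const_lt (u := ‖w‖) (by rwa [hΨ4])
      obtain ⟨σ, h, hσ⟩ := ((this.filter_mono nhdsWithin_le_nhds).and
        (self_mem_nhdsWithin : Set.Iio (0 : ℝ) ∈ 𝓝[<] 0)).exists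
      exact ⟨σ, hσ, h⟩
    have hconn : IsPreconnected (Set.Iio (0 : ℝ) ×ˢ (Set.univ : Set (ℝ × ℝ))) :=
      isPreconnected_Iio.prod isPreconnected_univ
    obtain ⟨⟨σ, x, y⟩, ⟨hσ, -⟩, hr⟩ := hconn.intermediate_value
      (a := (-1, x₀, y₀)) (b := (σ₁, 0, 0)) ⟨by simp, trivial⟩ ⟨hσ₁, trivial⟩
      hΨ.norm.continuousOn (show ‖w‖ ∈ Set.Icc _ _ from ⟨by simp [hΨ0], hσ₁'.le⟩)
    obtain ⟨u, hu, huw⟩ : ∃ u : ℂ, ‖u‖ = 1 ∧ u * Ψ (σ, x, y) = w := by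
      by_cases h : Ψ (σ, x, y) = 0
      · refine ⟨1, norm_one, ?_⟩
        simp only [h, norm_zero] at hr
        rw [h, mul_zero, norm_eq_zero.1 hr.symm]
      · refine ⟨w / Ψ (σ, x, y), ?_, div_mul_cancel₀ _ h⟩
        rw [norm_div, ← hr]
        exact div_self (norm_ne_zero_iff.2 h)
    let z : Fin 3 → ℂ := ![u, u * exp (x * I), u * exp (y * I)]
    have hz : ∀ i, ‖z i‖ = 1 := fun i => by
      fin_cases i <;> simp [z, hu, norm_exp_ofReal_mul_I]
    have hval : expSum ((fun i => (c i : ℂ)) * z) exLog σ = w := by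
      rw [← huw]
      simp only [expSum, Fin.sum_univ_three, Pi.mul_apply, z, Ψ, Matrix.cons_val]
      ring
    rw [← hval]
    exact mem_valuesOver_expSum linearIndependent_exLog isOpen_Iio hσ hz
      (exists_expSum_exLog_ne hc hc2 hsum hz _)

theorem valuesOver_exF₁ : valuesOver (Set.Iio 0) exF₁ = {w : ℂ | ‖w‖ < 4} := by
  rw [exF₁_eq_expSum]
  apply valuesOver_Iio_expSum_exLog
  · intro i; fin_cases i <;> simp
  all_goals norm_num [abs_le, show (![1, 1, 2] : Fin 3 → ℝ) 2 = 2 from rfl]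

theorem valuesOver_exF₂ : valuesOver (Set.Iio 0) exF₂ = {w : ℂ | ‖w‖ < 4} := by
  rw [exF₂_eq_expSum]
  apply valuesOver_Iio_expSum_exLog
  · intro i; fin_cases i <;> simp
  all_goals norm_num [abs_le, show (![1, 2, 1] : Fin 3 → ℝ) 2 = 1 from rfl]

theorem not_funEquiv_exF₁_exF₂ : ¬ FunEquiv exLambda ⊥ ⊤ exF₁ exF₂ := by
  rw [exF₁_eq_expSum, exF₂_eq_expSum, ← range_exLog]
  intro h
  have := h.norm_coeff_eq injective_exLog 2
  norm_num [show (![1, 1, 2] : Fin 3 → ℝ) 2 = 2 from rfl,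
    show (![1, 2, 1] : Fin 3 → ℝ) 2 = 1 from rfl] at this

theorem mainTheorem9 :
    exLambda.Countable ∧ HasIntegralBasis exLambda ∧
    IsExpPoly exLambda exF₁ ∧ IsExpPoly exLambda exF₂ ∧
    InClassD exLambda ⊥ ⊤ exF₁ ∧ InClassD exLambda ⊥ ⊤ exF₂ ∧
    ¬ FunEquiv exLambda ⊥ ⊤ exF₁ exF₂ ∧
    valuesOver (Set.Iio 0) exF₁ = {w : ℂ | ‖w‖ < 4} ∧
    valuesOver (Set.Iio 0) exF₂ = {w : ℂ | ‖w‖ < 4} ∧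
    ¬ SameValuesImpliesEquiv exLambda ⊥ ⊤ (Set.Iio 0) := by
  have hD₁ : InClassD exLambda ⊥ ⊤ exF₁ := by
    rw [exF₁_eq_expSum, ← range_exLog]
    exact inClassD_expSum _ injective_exLog _ _
  have hD₂ : InClassD exLambda ⊥ ⊤ exF₂ := by
    rw [exF₂_eq_expSum, ← range_exLog]
    exact inClassD_expSum _ injective_exLog _ _
  refine ⟨?_, hasIntegralBasis_exLambda, ?_, ?_, hD₁, hD₂, not_funEquiv_exF₁_exF₂,
    valuesOver_exF₁, valuesOver_exF₂, fun h => not_funEquiv_exF₁_exF₂ (h _ _ hD₁ hD₂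
      (valuesOver_exF₁.trans valuesOver_exF₂.symm))⟩
  · exact range_exLog ▸ Set.countable_range exLog
  · rw [exF₁_eq_expSum]
    exact isExpPoly_expSum _ injective_exLog range_exLog.subset
  · rw [exF₂_eq_expSum]
    exact isExpPoly_expSum _ injective_exLog range_exLog.subset
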